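/- **Models.** The processes are $\{1,\dots,n\}$. A run $E$ of the iterated immediate snapshot (IIS) model is a sequence $S_1\supseteq S_2\supseteq\cdots$ of non-empty sets of processes, each with an ordered partition; for $i\in S_r$ the view $V_{ir}$ is the union of the blocks of $S_r$ up to and including the block of $i$. Let $\infty\text{-}\mathrm{part}(E)=\bigcap_r S_r$, and let $G^*_E$ be the directed graph on $\infty\text{-}\mathrm{part}(E)$ with an edge $(i,j)$ iff $j\in V_{ir}$ for infinitely many $r$. The set $\mathit{str\text{-}correct}(E)$ of strongly correct processes is the sink strongly connected component of $G^*_E$. Process $i$ is aware of round $r$ of process $j$ if there are processes $j=k_0,k_1,\dots,k_m=i$ ($m\ge 1$) and rounds $r\le r_1<r_2<\dots<r_m$ such that $k_{l-1}\in V_{k_l r_l}$ for all $1\le l\le m$; $\mathrm{part}(E,i)$ is the set of processes of whose first round $i$ is aware. In the atomic snapshot (AS) model each process has one register and alternates atomic updates of it with atomic snapshots of all registers, starting with an update. Process $i$ keeps a vector in $\mathbb N^n$, initially $1$ at position $i$ and $0$ elsewhere (registers initially hold $0$); an update writes this vector to its register; the value of a snapshot is the position-wise maximum of all registers, and after a snapshot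 the process takes this value, incremented by $1$ at position $i$, as its new vector. A run $E'$ is an infinite sequence of such steps; $\mathrm{correct}(E')$ is the set of processes taking infinitely many steps, $\mathrm{part}(E')$ the set of processes performing at least one update, and $\mathrm{part}(E',i)$ the set of $j$ such that some snapshot of $i$ has a non-zero entry at position $j$. **Algorithm.** In the IIS model process $i$ keeps vectors $C_i,SI_i\in\mathbb N^n$, initially $C_i[i]=1$ and all other entries of both $0$. In each round $r$ in which it participates, it writes $(C_i,SI_i)$ to the $r$-th memory and obtains the pairs $(C_j,SI_j)$ written by the processes $j\in V_{ir}$. If there is a vector $U$ such that either $C_j=U$ for all $j\in V_{ir}$, or $SI_j=U$ for some $j\in V_{ir}$ and $U[i]=C_i[i]$, then it chooses such a $U$, outputs it, sets $SI_i:=U$ and increments $C_i[i]$. In any case it then replaces $C_i$ by the position-wise maximum of $C_i$ and the vectors $C_j$, $j\in V_{ir}$, that it read. **Theorem.** This algorithm simulates the AS model in the IIS model: for every IIS run $E$ and every execution of the algorithm in $E$, there is an AS run $E'$ such that for every process $i$ the (finite or infinite) sequence of values of the snapshots of $i$ in $E'$ is exactly the sequence of outputs of $i$, and $\mathrm{part}(E,i)=\mathrm{part}(E',i)$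 for every $i\in\mathit{str\text{-}correct}(E)$. Moreover, every such $E'$ satisfies 1. $\mathit{str\text{-}correct}(E)=\mathrm{correct}(E')$, and 2. $\mathrm{part}(E,i)=\mathrm{part}(E')$ for every $i\in\mathit{str\text{-}correct}(E)$. -/

import Mathlib

/-! ### The iterated immediate snapshot model (IIS)

The processes are the elements of `Fin n`; the rounds are numbered `0, 1, 2, …`. -/

/-- A run of the IIS model: a non-increasing sequence of non-empty sets `S r` of processes, those
that access the `r`-th memory, each of them with an ordered partition.  The ordered partition of
`S r` is given by `block r`, which tells in which block a process of `S r` lies: the blocks are the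
non-empty sets `{j ∈ S r | block r j = m}`, in the order of `m`.  (The values of `block r` outside
`S r` are never used.) -/
structure IISRun (n : ℕ) where
  S : ℕ → Finset (Fin n)
  nonempty : ∀ r, (S r).Nonempty
  decreasing : ∀ r, S (r + 1) ⊆ S r
  block : ℕ → Fin n → ℕ

namespace IISRun

variable {n : ℕ} (E : IISRun n)

/-- The set of processes in the immediate snapshot of `i` in round `r` (for `i ∈ S r`): the
union of the blocks of `S r` up to and including the block of `i`. -/
def view (r : ℕ) (i : Fin n) : Finset (Fin n) :=
  (E.S r).filter fun j => E.block r j ≤ E.block r i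

/-- The edges of the graph of round `r`: `i` participates in round `r` and has `j` in its view. -/
def Sees (r : ℕ) (i j : Fin n) : Prop :=
  i ∈ E.S r ∧ j ∈ E.view r i

/-- The processes that participate in every round. -/
def infPart : Set (Fin n) :=
  {i | ∀ r, i ∈ E.S r}

/-- `E.AwareAt r j q i`: after round `q`, process `i` is aware of round `r` of process `j`.  That is,
information that `j` writes in round `r` or later has reached `i` by round `q`: there is a path from
`i` to `j` in the union of the graphs of the rounds `≥ r` whose edges, read from `j` to `i`, belong
to successively later rounds. -/
inductive AwareAt (r : ℕ) (j : Fin n) : ℕ → Fin n → Prop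
  | direct {q : ℕ} {i : Fin n} : r ≤ q → E.Sees q i j → AwareAt r j q i
  | relay {p q : ℕ} {k i : Fin n} : AwareAt r j p k → p < q → E.Sees q i k → AwareAt r j q i

/-- Process `i` is aware of round `r` of process `j`. -/
def Aware (i : Fin n) (r : ℕ) (j : Fin n) : Prop :=
  ∃ q, E.AwareAt r j q i

/-- The participating set of `i`: the processes of whose first round `i` is aware. -/
def partOf (i : Fin n) : Set (Fin n) :=
  {j | E.Aware i 0 j}

/-- The edges of the limit graph, whose vertices are the infinitely participating processes:
`i` has `j` in its view in infinitely many rounds. -/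
def LimitEdge (i j : Fin n) : Prop :=
  i ∈ E.infPart ∧ j ∈ E.infPart ∧ {r | E.Sees r i j}.Infinite

/-- The strongly correct processes: the vertices of the limit graph that lie in a sink strongly
connected component, i.e. that can be reached back from every vertex that they reach. -/
def strCorrect : Set (Fin n) :=
  {i | i ∈ E.infPart ∧
    ∀ j, Relation.ReflTransGen E.LimitEdge i j → Relation.ReflTransGen E.LimitEdge j i}

end IISRun

/-! ### The atomic snapshot model (AS)

Each process alternates updates and snapshots, starting with an update.  It maintains a vector of
counters; an update writes this vector to the register of the process, a snapshot reads all the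
registers, merges the vectors found there, and then increments the own counter of the process. -/

/-- A configuration: the registers, the local vectors, and for each process whether its next step
is an update (otherwise it is a snapshot). -/
structure ASConfig (n : ℕ) where
  mem : Fin n → Fin n → ℕ
  vec : Fin n → Fin n → ℕ
  updateNext : Fin n → Bool

namespace ASConfig

variable {n : ℕ}

/-- Initially all registers hold the zero vector (nothing written), the vector of process `i` is
`1` at position `i` and `0` elsewhere, and the first step of every process is an update. -/
def init (n : ℕ) : ASConfig n where
  mem := fun _ _ => 0
  vec := fun i => Pi.single i 1
  updateNext := fun _ => true

/-- The value of a snapshot of the memory: the position-wise maximum of all registers. -/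
def snapshot (c : ASConfig n) : Fin n → ℕ :=
  fun k => Finset.univ.sup fun j => c.mem j k

/-- The configuration after the next step of process `i`. -/
def step (c : ASConfig n) (i : Fin n) : ASConfig n :=
  if c.updateNext i = true then
    { mem := Function.update c.mem i (c.vec i)
      vec := c.vec
      updateNext := Function.update c.updateNext i false }
  else
    { mem := c.mem
      vec := Function.update c.vec i (c.snapshot + Pi.single i 1)
      updateNext := Function.update c.updateNext i true }

end ASConfig

/-- A run of the AS model is determined by its schedule: `sched t` is the process that takes the
`t`-th step. -/
structure ASRun (n : ℕ) where
  sched : ℕ → Fin n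

namespace ASRun

variable {n : ℕ} (E : ASRun n)

/-- The configuration before step `t`. -/
def config : ℕ → ASConfig n
  | 0 => ASConfig.init n
  | t + 1 => (config t).step (E.sched t)

/-- The value of the snapshot taken by process `i` in step `t`, if step `t` is a snapshot by `i`. -/
def snap (t : ℕ) (i : Fin n) : Option (Fin n → ℕ) :=
  if E.sched t = i ∧ (E.config t).updateNext i = false then some (E.config t).snapshot else none

/-- The participating processes: those that perform at least one update. -/
def part : Set (Fin n) :=
  {i | ∃ t, E.sched t = i ∧ (E.config t).updateNext i = true}

/-- The correct processes: those that take infinitely many steps. -/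
def correct : Set (Fin n) :=
  {i | {t | E.sched t = i}.Infinite}

/-- The participating set of `i`: the processes that appear in the snapshots of `i`. -/
def partOf (i : Fin n) : Set (Fin n) :=
  {j | ∃ t v, E.snap t i = some v ∧ v j ≠ 0}

end ASRun

/-! ### The simulation algorithm -/

/-- The local variables of a process: its counter vector and its last snapshot. -/
structure SimState (n : ℕ) where
  C : Fin n → ℕ
  SI : Fin n → ℕ

namespace SimState

variable {n : ℕ}

/-- Initially the own counter is `1`, all other entries are `0`. -/
def init (i : Fin n) : SimState n where
  C := Pi.single i 1
  SI := fun _ => 0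

/-- The vectors `U` that process `i` may output in a round in which each process `j` has written
`st j` and the view of `i` is `V`: either all the counter vectors in the view equal `U`, or `U` is
the last snapshot of some process in the view and contains the current counter of `i`. -/
def CanOutput (st : Fin n → SimState n) (V : Finset (Fin n)) (i : Fin n) (U : Fin n → ℕ) : Prop :=
  (∀ j ∈ V, (st j).C = U) ∨ (∃ j ∈ V, (st j).SI = U ∧ U i = (st i).C i)

/-- One iteration of process `i`: from the states `st` written by the processes, the view `V` of
`i`, to the output `o` (if any) and the new state `st'` of `i`.  If some vector can be output, the
process outputs such a vector and increments its own counter; at any rate it ends with the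
position-wise maximum of its counter vector and those in its view. -/
def Iteration (st : Fin n → SimState n) (V : Finset (Fin n)) (i : Fin n)
    (o : Option (Fin n → ℕ)) (st' : SimState n) : Prop :=
  (∃ U, CanOutput st V i U ∧ o = some U ∧ st'.SI = U ∧
      st'.C = ((st i).C + Pi.single i 1) ⊔ V.sup fun j => (st j).C) ∨
  ((¬ ∃ U, CanOutput st V i U) ∧ o = none ∧ st'.SI = (st i).SI ∧
      st'.C = (st i).C ⊔ V.sup fun j => (st j).C)

end SimState

/-- An execution of the algorithm in the IIS run `E`: `state r i` is the state of process `i` at the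
beginning of round `r`, and `out r i` is what `i` outputs in round `r`, if anything.  Where several
vectors can be output, any of them may be. -/
structure SimExec {n : ℕ} (E : IISRun n) where
  state : ℕ → Fin n → SimState n
  out : ℕ → Fin n → Option (Fin n → ℕ)
  state_zero : ∀ i, state 0 i = SimState.init i
  iterate : ∀ r, ∀ i ∈ E.S r,
    SimState.Iteration (state r) (E.view r i) i (out r i) (state (r + 1) i)
  idle : ∀ r, ∀ i ∉ E.S r, out r i = none ∧ state (r + 1) i = state r i

/-- The algorithm never gets stuck: in every IIS run it has an execution. -/
theorem SimExec.nonempty {n : ℕ} (E : IISRun n) : Nonempty (SimExec E) := by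
  classical
  have tot : ∀ (st : Fin n → SimState n) (V : Finset (Fin n)) (i : Fin n),
      ∃ p : Option (Fin n → ℕ) × SimState n, SimState.Iteration st V i p.1 p.2 := by
    intro st V i
    by_cases h : ∃ U, SimState.CanOutput st V i U
    · obtain ⟨U, hU⟩ := h
      exact ⟨(some U, ⟨((st i).C + Pi.single i 1) ⊔ V.sup fun j => (st j).C, U⟩),
        Or.inl ⟨U, hU, rfl, rfl, rfl⟩⟩
    · exact ⟨(none, ⟨(st i).C ⊔ V.sup fun j => (st j).C, (st i).SI⟩),
        Or.inr ⟨h, rfl, rfl, rfl⟩⟩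
  choose f hf using tot
  let state : ℕ → Fin n → SimState n := fun r =>
    Nat.rec SimState.init
      (fun r st i => if i ∈ E.S r then (f st (E.view r i) i).2 else st i) r
  have hs : ∀ r i, state (r + 1) i =
      if i ∈ E.S r then (f (state r) (E.view r i) i).2 else state r i := fun _ _ => rfl
  refine ⟨⟨state, fun r i => if i ∈ E.S r then (f (state r) (E.view r i) i).1 else none,
    fun _ => rfl, fun r i hi => ?_, fun r i hi => ?_⟩⟩
  · rw [hs, if_pos hi, if_pos hi]
    exact hf _ _ _
  · rw [hs, if_neg hi, if_neg hi]
    exact ⟨rfl, rfl⟩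

/-! ### Simulations -/

/-- `IsNth f k a`: the `k`-th (from `0`) of the values emitted by `f` over time is `a`. -/
def IsNth {α : Type*} (f : ℕ → Option α) (k : ℕ) (a : α) : Prop :=
  ∃ t, f t = some a ∧ Nat.count (fun s => (f s).isSome = true) t = k

/-- `f` and `g` emit the same, finite or infinite, sequence of values. -/
def SameSequence {α : Type*} (f g : ℕ → Option α) : Prop :=
  ∀ k a, IsNth f k a ↔ IsNth g k a

/-- The AS run `E'` is simulated by the outputs `out` in the IIS run `E`: the sequence of snapshots
that each process takes in `E'` is exactly the sequence of its outputs, and every strongly correct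
process of `E` has the same participating set in `E` and in `E'`. -/
def IsSimulatedRun {n : ℕ} (E : IISRun n) (out : ℕ → Fin n → Option (Fin n → ℕ))
    (E' : ASRun n) : Prop :=
  (∀ i, SameSequence (fun r => out r i) (fun t => E'.snap t i)) ∧
    ∀ i ∈ E.strCorrect, E.partOf i = E'.partOf i

/-!
**The outputs form a chain.** Call `U` a direct output of round `r` if some process finds `U` as the
counter vector of everybody in its view; every output is a direct output, possibly adopted by way of
the variables `SI`. As any two participants of a round see one another in at least one direction,
everybody in `S r` knows `U` after round `r`, so direct outputs grow from round to round and those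
of one round are equal (`SimExec.out_le_or_le`). The own counter of `i` numbers the outputs of `i`:
its `k`-th output `U` has `U i = k` (`SimExec.C_self_eq_count`).

**Causality.** Entries at position `b` originate at `b`, so a vector whose entry at `b` exceeds the
counter of `b` at some round contains all that `b` knew at that round (`SimExec.C_le_of_lt_apply`).

**The strongly correct processes are those that output forever.** They eventually see only one
another. If they all stopped, their vectors would become constant and, by strong connectivity,
equal, which makes an output possible (`SimExec.exists_outputsForever`). If `a` sees `b` infinitely
often, `b` outputs forever, but `a` stops, then by causality the snapshots of `b` eventually contain
the last counter of `a`, and `a` can adopt one (`SimExec.OutputsForever.of_limitEdge`). Conversely,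
the late counters of a process `i` that is not strongly correct are unknown to a strongly correct
process `q`; if `i` output forever, a late output of `i` would be contained in no output of `q`,
hence contain all of them, although their entries at `q` are unbounded
(`SimExec.mem_strCorrect_of_outputsForever`).

**The simulated run.** In the AS model the value of a snapshot is the vector that counts the updates
of each process so far. An infinite chain of vectors numbered as above is realized by a greedy
schedule that always works towards the least snapshot still to be taken
(`IsSnapshotFamily.exists_run`). Its infinity, which makes the schedule infinite, is the liveness
of the strongly correct processes. In any simulated run, the correct processes are those that take
infinitely many snapshots, hence those that output forever, and a correct process takes a snapshot
after the first update of any participant, so that it sees all participants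
(`ASRun.partOf_eq_part`).
-/

/-! ### Views of an immediate snapshot -/

namespace IISRun

variable {n : ℕ} (E : IISRun n)

theorem S_antitone : Antitone E.S :=
  antitone_nat_of_succ_le E.decreasing

variable {E}

theorem self_mem_view {r : ℕ} {i : Fin n} (hi : i ∈ E.S r) : i ∈ E.view r i := by
  simp [view, hi]

theorem mem_S_of_mem_view {r : ℕ} {i j : Fin n} (hj : j ∈ E.view r i) : j ∈ E.S r :=
  (Finset.mem_filter.mp hj).1

theorem view_subset_or_subset (r : ℕ) (i j : Fin n) :
    E.view r i ⊆ E.view r j ∨ E.view r j ⊆ E.view r i := by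
  rcases le_total (E.block r i) (E.block r j) with h | h
  · left; intro k; simp only [view, Finset.mem_filter]; exact fun hk => ⟨hk.1, hk.2.trans h⟩
  · right; intro k; simp only [view, Finset.mem_filter]; exact fun hk => ⟨hk.1, hk.2.trans h⟩

theorem sees_or_sees {r : ℕ} {i j : Fin n} (hi : i ∈ E.S r) (hj : j ∈ E.S r) :
    E.Sees r i j ∨ E.Sees r j i := by
  rcases view_subset_or_subset (E := E) r i j with h | h
  · exact Or.inr ⟨hj, h (self_mem_view hi)⟩
  · exact Or.inl ⟨hi, h (self_mem_view hj)⟩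

end IISRun

/-! ### Evolution of the counters -/

namespace SimExec

variable {n : ℕ} {E : IISRun n} (X : SimExec E)

theorem state_succ_of_out_none {r : ℕ} {i : Fin n} (h : X.out r i = none) :
    (X.state (r + 1) i).SI = (X.state r i).SI ∧
      (X.state (r + 1) i).C i ≤ (X.state r i).C i ⊔
        (E.view r i).sup (fun j => (X.state r j).C) i := by
  by_cases hi : i ∈ E.S r
  · rcases X.iterate r i hi with ⟨U, -, ho, -⟩ | ⟨-, -, hSI, hC⟩
    · simp [ho] at h
    · exact ⟨hSI, by rw [hC]; rfl⟩
  · rw [(X.idle r i hi).2]; exact ⟨rfl, le_sup_left⟩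

/-- An output is contained in the counters the process ends the round with: it is either the
counter vector of the process itself, or the last snapshot of a process in its view. -/
theorem of_out {r : ℕ} {i : Fin n} {U : Fin n → ℕ} (h : X.out r i = some U) :
    i ∈ E.S r ∧ SimState.CanOutput (X.state r) (E.view r i) i U ∧
      (X.state (r + 1) i).SI = U ∧
      (X.state (r + 1) i).C =
        ((X.state r i).C + Pi.single i 1) ⊔ (E.view r i).sup fun j => (X.state r j).C := by
  by_cases hi : i ∈ E.S r
  · rcases X.iterate r i hi with ⟨U', hU, ho, hSI, hC⟩ | ⟨-, ho, -⟩
    · rw [ho] at h; cases h; exact ⟨hi, hU, hSI, hC⟩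
    · simp [ho] at h
  · simp [(X.idle r i hi).1] at h

theorem exists_out_of_canOutput {r : ℕ} {i : Fin n} {U : Fin n → ℕ} (hi : i ∈ E.S r)
    (h : SimState.CanOutput (X.state r) (E.view r i) i U) : (X.out r i).isSome = true := by
  rcases X.iterate r i hi with ⟨U', -, ho, -⟩ | ⟨hn, -⟩
  · simp [ho]
  · exact (hn ⟨U, h⟩).elim

theorem C_le_succ (r : ℕ) (i : Fin n) : (X.state r i).C ≤ (X.state (r + 1) i).C := by
  by_cases hi : i ∈ E.S r
  · rcases X.iterate r i hi with ⟨U', -, -, -, hC⟩ | ⟨-, -, -, hC⟩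
    · rw [hC]; exact le_sup_of_le_left (le_add_of_nonneg_right zero_le)
    · rw [hC]; exact le_sup_left
  · rw [(X.idle r i hi).2]

theorem C_mono (i : Fin n) : Monotone fun r => (X.state r i).C :=
  monotone_nat_of_le_succ fun r => X.C_le_succ r i

theorem C_le_succ_of_sees {r : ℕ} {i j : Fin n} (h : E.Sees r i j) :
    (X.state r j).C ≤ (X.state (r + 1) i).C := by
  have hj := Finset.le_sup (f := fun j => (X.state r j).C) h.2
  rcases X.iterate r i h.1 with ⟨U', -, -, -, hC⟩ | ⟨-, -, -, hC⟩
  · rw [hC]; exact le_sup_of_le_right hj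
  · rw [hC]; exact le_sup_of_le_right hj

/-- An entry for another process is never created, only copied from a vector that was read. -/
theorem exists_C_succ_apply_eq (r : ℕ) {i k : Fin n} (hk : k ≠ i) :
    ∃ j, (j = i ∨ E.Sees r i j) ∧ (X.state (r + 1) i).C k = (X.state r j).C k := by
  by_cases hi : i ∈ E.S r
  · have key : (X.state (r + 1) i).C k =
        (X.state r i).C k ⊔ (E.view r i).sup fun j => (X.state r j).C k := by
      rcases X.iterate r i hi with ⟨U', -, -, -, hC⟩ | ⟨-, -, -, hC⟩
      · simp [hC, hk, Finset.sup_apply]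
      · simp [hC, Finset.sup_apply]
    obtain ⟨j, hj, hj'⟩ := Finset.exists_mem_eq_sup (E.view r i) ⟨i, IISRun.self_mem_view hi⟩
      fun j => (X.state r j).C k
    rw [hj'] at key
    rcases le_total ((X.state r i).C k) ((X.state r j).C k) with h | h
    · exact ⟨j, Or.inr ⟨hi, hj⟩, by rw [key, sup_eq_right.mpr h]⟩
    · exact ⟨i, Or.inl rfl, by rw [key, sup_eq_left.mpr h]⟩
  · exact ⟨i, Or.inl rfl, by rw [(X.idle r i hi).2]⟩

theorem C_apply_le_self (r : ℕ) (j k : Fin n) : (X.state r j).C k ≤ (X.state r k).C k := by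
  induction r generalizing j with
  | zero =>
    rw [X.state_zero, X.state_zero]
    rcases eq_or_ne k j with rfl | h
    · rfl
    · simp [SimState.init, h]
  | succ r ih =>
    rcases eq_or_ne k j with rfl | h
    · rfl
    · obtain ⟨l, -, hl⟩ := X.exists_C_succ_apply_eq r h
      rw [hl]; exact (ih l).trans (X.C_le_succ r k k)

theorem sup_C_apply_le (r : ℕ) (i : Fin n) :
    (E.view r i).sup (fun j => (X.state r j).C) i ≤ (X.state r i).C i := by
  rw [Finset.sup_apply]; exact Finset.sup_le fun j _ => X.C_apply_le_self r j i

theorem C_succ_self_of_none {r : ℕ} {i : Fin n} (h : X.out r i = none) :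
    (X.state (r + 1) i).C i = (X.state r i).C i :=
  le_antisymm ((X.state_succ_of_out_none h).2.trans (sup_le le_rfl (X.sup_C_apply_le r i)))
    (X.C_le_succ r i i)

theorem C_succ_self_of_some {r : ℕ} {i : Fin n} {U : Fin n → ℕ} (h : X.out r i = some U) :
    (X.state (r + 1) i).C i = (X.state r i).C i + 1 := by
  have := X.sup_C_apply_le r i
  rw [(X.of_out h).2.2.2]
  simp only [Pi.sup_apply, Pi.add_apply, Pi.single_eq_same]
  exact sup_eq_left.mpr (by omega)

theorem apply_self_of_out {r : ℕ} {i : Fin n} {U : Fin n → ℕ} (h : X.out r i = some U) :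
    U i = (X.state r i).C i := by
  obtain ⟨hi, hU | ⟨j, -, -, hj⟩, -⟩ := X.of_out h
  · rw [hU i (IISRun.self_mem_view hi)]
  · exact hj

/-- The own counter of a process numbers its outputs, starting from `1`. -/
theorem C_self_eq_count (r : ℕ) (i : Fin n) :
    (X.state r i).C i = Nat.count (fun s => (X.out s i).isSome = true) r + 1 := by
  induction r with
  | zero => simp [X.state_zero, SimState.init]
  | succ r ih =>
    rw [Nat.count_succ]
    cases h : X.out r i with
    | none => rw [X.C_succ_self_of_none h, ih]; simp
    | some U => rw [X.C_succ_self_of_some h, ih]; simp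

theorem SI_self (r : ℕ) (i : Fin n) : (X.state r i).SI i + 1 = (X.state r i).C i := by
  induction r with
  | zero => simp [X.state_zero, SimState.init]
  | succ r ih =>
    cases h : X.out r i with
    | none => rw [X.C_succ_self_of_none h, (X.state_succ_of_out_none h).1, ih]
    | some U => rw [X.C_succ_self_of_some h, (X.of_out h).2.2.1, X.apply_self_of_out h]

theorem SI_le_C (r : ℕ) (i : Fin n) : (X.state r i).SI ≤ (X.state r i).C := by
  induction r generalizing i with
  | zero => rw [X.state_zero]; exact fun _ => Nat.zero_le _
  | succ r ih =>
    cases h : X.out r i with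
    | none => rw [(X.state_succ_of_out_none h).1]; exact (ih i).trans (X.C_le_succ r i)
    | some U =>
      obtain ⟨hi, hU | ⟨j, hj, hj', -⟩, hSI, -⟩ := X.of_out h
      · rw [hSI, ← hU i (IISRun.self_mem_view hi)]; exact X.C_le_succ r i
      · rw [hSI, ← hj']; exact (ih j).trans (X.C_le_succ_of_sees ⟨hi, hj⟩)

theorem out_le_C_succ {r : ℕ} {i : Fin n} {U : Fin n → ℕ} (h : X.out r i = some U) :
    U ≤ (X.state (r + 1) i).C :=
  (X.of_out h).2.2.1 ▸ X.SI_le_C (r + 1) i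

/-- Causality: whoever has heard of a counter of `b` beyond its value at round `s` knows all that
`b` knew at round `s`. -/
theorem C_le_of_lt_apply {s r : ℕ} {b k : Fin n}
    (h : (X.state s b).C b < (X.state r k).C b) : (X.state s b).C ≤ (X.state r k).C := by
  induction r generalizing k with
  | zero =>
    exact absurd ((X.C_apply_le_self 0 k b).trans (X.C_mono b (Nat.zero_le s) b)) (not_le.mpr h)
  | succ r ih =>
    rcases eq_or_ne b k with rfl | hb
    · rcases le_total s (r + 1) with hs | hs
      · exact X.C_mono b hs
      · exact absurd (X.C_mono b hs b) (not_le.mpr h)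
    · obtain ⟨j, hj, hj'⟩ := X.exists_C_succ_apply_eq r hb
      rw [hj'] at h
      refine (ih h).trans ?_
      rcases hj with rfl | hj
      · exact X.C_le_succ r j
      · exact X.C_le_succ_of_sees hj

/-! ### Outputs form a chain -/

/-- In round `r` some process finds the vector `U` as the counter vector of its whole view, so that
it can output `U` without adopting it from another process. -/
def Direct (r : ℕ) (U : Fin n → ℕ) : Prop :=
  ∃ i ∈ E.S r, ∀ j ∈ E.view r i, (X.state r j).C = U

variable {X}

theorem Direct.exists_eq_C {r : ℕ} {U : Fin n → ℕ} (h : X.Direct r U) :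
    ∃ i ∈ E.S r, (X.state r i).C = U := by
  obtain ⟨i, hi, h⟩ := h
  exact ⟨i, hi, h i (IISRun.self_mem_view hi)⟩

/-- After a round with a direct output `U`, everybody who took part in the round knows `U`. -/
theorem Direct.le_C_succ {r : ℕ} {U : Fin n → ℕ} (h : X.Direct r U) {k : Fin n}
    (hk : k ∈ E.S r) : U ≤ (X.state (r + 1) k).C := by
  obtain ⟨i, hi, h⟩ := h
  rcases IISRun.sees_or_sees hi hk with hs | hs
  · rw [← h k hs.2]; exact X.C_le_succ r k
  · rw [← h i (IISRun.self_mem_view hi)]; exact X.C_le_succ_of_sees hs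

theorem Direct.le_of_lt {r s : ℕ} {U W : Fin n → ℕ} (hU : X.Direct r U) (hW : X.Direct s W)
    (hrs : r < s) : U ≤ W := by
  obtain ⟨k, hk, rfl⟩ := hW.exists_eq_C
  exact (hU.le_C_succ (E.S_antitone hrs.le hk)).trans (X.C_mono k hrs)

theorem Direct.le_or_le {r s : ℕ} {U W : Fin n → ℕ} (hU : X.Direct r U) (hW : X.Direct s W) :
    U ≤ W ∨ W ≤ U := by
  rcases lt_trichotomy r s with h | rfl | h
  · exact Or.inl (hU.le_of_lt hW h)
  · obtain ⟨i, hi, hU⟩ := hU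
    obtain ⟨j, hj, hW⟩ := hW
    have hUW : U = W := by
      rcases IISRun.sees_or_sees hi hj with hs | hs
      · rw [← hU j hs.2, hW j (IISRun.self_mem_view hj)]
      · rw [← hW i hs.2, hU i (IISRun.self_mem_view hi)]
    exact Or.inl hUW.le
  · exact Or.inr (hW.le_of_lt hU h)

variable (X)

theorem SI_eq_zero_or_direct (r : ℕ) (i : Fin n) :
    (X.state r i).SI = 0 ∨ ∃ s, X.Direct s (X.state r i).SI := by
  induction r generalizing i with
  | zero => left; rw [X.state_zero]; rfl
  | succ r ih =>
    cases h : X.out r i with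
    | none => rw [(X.state_succ_of_out_none h).1]; exact ih i
    | some U =>
      obtain ⟨hi, hU | ⟨j, hj, hj', -⟩, hSI, -⟩ := X.of_out h
      · rw [hSI]; exact Or.inr ⟨r, i, hi, hU⟩
      · rw [hSI, ← hj']; exact ih j

theorem direct_of_SI {r : ℕ} {i b : Fin n} (h : (X.state r i).SI b ≠ 0) :
    ∃ s, X.Direct s (X.state r i).SI :=
  (X.SI_eq_zero_or_direct r i).resolve_left fun h0 => h (by rw [h0]; rfl)

theorem direct_of_out {r : ℕ} {i : Fin n} {U : Fin n → ℕ} (h : X.out r i = some U) :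
    ∃ s, X.Direct s U := by
  have hSI := (X.of_out h).2.2.1
  have hne : (X.state (r + 1) i).SI i ≠ 0 := by
    rw [hSI, X.apply_self_of_out h, X.C_self_eq_count]; exact Nat.succ_ne_zero _
  simpa only [hSI] using X.direct_of_SI hne

theorem out_le_or_le {r s : ℕ} {i j : Fin n} {U W : Fin n → ℕ} (hU : X.out r i = some U)
    (hW : X.out s j = some W) : U ≤ W ∨ W ≤ U := by
  obtain ⟨_, hU⟩ := X.direct_of_out hU
  obtain ⟨_, hW⟩ := X.direct_of_out hW
  exact hU.le_or_le hW

/-- A snapshot that contains a counter of `b` beyond its value at round `s` contains all that `b`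
knew at round `s`. -/
theorem C_le_SI_of_lt_apply {s r : ℕ} {b k : Fin n}
    (h : (X.state s b).C b < (X.state r k).SI b) : (X.state s b).C ≤ (X.state r k).SI := by
  obtain ⟨q, hq⟩ := X.direct_of_SI (Nat.ne_zero_of_lt h)
  obtain ⟨l, -, hl⟩ := hq.exists_eq_C
  rw [← hl] at h ⊢
  exact X.C_le_of_lt_apply h

end SimExec

/-! ### The sink component of the limit graph -/

namespace IISRun

variable {n : ℕ} {E : IISRun n}

theorem limitEdge_or_limitEdge {i j : Fin n} (hi : i ∈ E.infPart) (hj : j ∈ E.infPart) :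
    E.LimitEdge i j ∨ E.LimitEdge j i := by
  have h : {r | E.Sees r i j} ∪ {r | E.Sees r j i} = Set.univ :=
    Set.eq_univ_of_forall fun r => sees_or_sees (hi r) (hj r)
  rcases Set.infinite_union.mp (h ▸ Set.infinite_univ) with h | h
  · exact Or.inl ⟨hi, hj, h⟩
  · exact Or.inr ⟨hj, hi, h⟩

theorem infPart_nonempty (E : IISRun n) : E.infPart.Nonempty := by
  by_contra h
  have h' : ∀ i, ∃ r, i ∉ E.S r := fun i => by
    by_contra! hi
    exact h ⟨i, hi⟩
  choose f hf using h'
  obtain ⟨i, hi⟩ := E.nonempty (Finset.univ.sup f)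
  exact hf i (E.S_antitone (Finset.le_sup (Finset.mem_univ i)) hi)

/-- A vertex of the limit graph that reaches the fewest vertices lies in the sink component. -/
theorem strCorrect_nonempty (E : IISRun n) : E.strCorrect.Nonempty := by
  obtain ⟨i, hi, hmin⟩ := Set.exists_min_image E.infPart
    (fun i => {j | Relation.ReflTransGen E.LimitEdge i j}.ncard) (Set.toFinite _)
    (infPart_nonempty E)
  refine ⟨i, hi, fun j hij => ?_⟩
  have hj : j ∈ E.infPart := by
    rcases hij.cases_tail with rfl | ⟨_, _, h⟩
    exacts [hi, h.2.1]
  have hsub : {k | Relation.ReflTransGen E.LimitEdge j k} ⊆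
      {k | Relation.ReflTransGen E.LimitEdge i k} := fun k hk => hij.trans hk
  have heq := Set.eq_of_subset_of_ncard_le hsub (hmin j hj) (Set.toFinite _)
  exact (heq ▸ Relation.ReflTransGen.refl :
    i ∈ {k | Relation.ReflTransGen E.LimitEdge j k})

theorem mem_strCorrect_of_limitEdge {i j : Fin n} (hi : i ∈ E.strCorrect)
    (h : E.LimitEdge i j) : j ∈ E.strCorrect :=
  ⟨h.2.1, fun k hk => (hi.2 k (hk.head h)).tail h⟩

theorem reflTransGen_of_mem_strCorrect {i j : Fin n} (hi : i ∈ E.strCorrect)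
    (hj : j ∈ E.strCorrect) : Relation.ReflTransGen E.LimitEdge i j := by
  rcases limitEdge_or_limitEdge hi.1 hj.1 with h | h
  · exact .single h
  · exact hj.2 i (.single h)

/-- From some round on, strongly correct processes see only strongly correct processes. -/
theorem exists_forall_view_subset (E : IISRun n) :
    ∃ R, ∀ r ≥ R, ∀ i ∈ E.strCorrect, ∀ j ∈ E.view r i, j ∈ E.strCorrect := by
  have h : ∀ i j, ∃ R, ∀ r ≥ R, i ∈ E.strCorrect → j ∈ E.view r i → j ∈ E.strCorrect := by
    intro i j
    by_cases hj : j ∈ E.strCorrect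
    · exact ⟨0, fun _ _ _ _ => hj⟩
    by_cases hi : i ∈ E.strCorrect
    · by_cases hjp : j ∈ E.infPart
      · have hfin : {r | E.Sees r i j}.Finite := by
          by_contra hinf
          exact hj (mem_strCorrect_of_limitEdge hi ⟨hi.1, hjp, hinf⟩)
        obtain ⟨R, hR⟩ := hfin.bddAbove
        refine ⟨R + 1, fun r hr _ hv => ?_⟩
        have : r ≤ R := hR ⟨hi.1 r, hv⟩
        omega
      · obtain ⟨R, hR⟩ := not_forall.mp hjp
        exact ⟨R, fun r hr _ hv => (hR (E.S_antitone hr (mem_S_of_mem_view hv))).elim⟩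
    · exact ⟨0, fun _ _ h => (hi h).elim⟩
  choose f hf using h
  refine ⟨Finset.univ.sup fun i => Finset.univ.sup (f i), fun r hr i hi j hj => ?_⟩
  refine hf i j r (le_trans ?_ hr) hi hj
  exact (Finset.le_sup (f := f i) (Finset.mem_univ j)).trans
    (Finset.le_sup (f := fun i => Finset.univ.sup (f i)) (Finset.mem_univ i))

end IISRun

/-! ### Strongly correct processes output infinitely often -/

namespace SimExec

variable {n : ℕ} {E : IISRun n} (X : SimExec E)

/-- Process `i` outputs infinitely often. -/
def OutputsForever (i : Fin n) : Prop :=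
  {r | (X.out r i).isSome = true}.Infinite

variable {X}

theorem OutputsForever.exists_out {i : Fin n} (h : X.OutputsForever i) (m : ℕ) :
    ∃ r U, X.out r i = some U ∧ (X.state r i).C i = m + 1 ∧ U i = m + 1 := by
  have hm := Nat.nth_mem_of_infinite h m
  obtain ⟨U, hU⟩ := Option.isSome_iff_exists.mp hm
  have hC : (X.state (Nat.nth (fun r => (X.out r i).isSome = true) m) i).C i = m + 1 := by
    rw [X.C_self_eq_count, Nat.count_nth_of_infinite h]
  exact ⟨_, U, hU, hC, (X.apply_self_of_out hU).trans hC⟩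

theorem exists_forall_out_eq_none {i : Fin n} (h : ¬ X.OutputsForever i) :
    ∃ R, ∀ r ≥ R, X.out r i = none := by
  obtain ⟨R, hR⟩ := (Set.not_infinite.mp h).bddAbove
  refine ⟨R + 1, fun r hr => Option.not_isSome_iff_eq_none.mp fun hs => ?_⟩
  have : r ≤ R := hR hs
  omega

theorem C_self_eq_of_out_eq_none {i : Fin n} {R : ℕ} (h : ∀ r ≥ R, X.out r i = none) {r : ℕ}
    (hr : R ≤ r) : (X.state r i).C i = (X.state R i).C i := by
  induction r, hr using Nat.le_induction with
  | base => rfl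
  | succ r hr ih => rw [X.C_succ_self_of_none (h r hr), ih]

theorem exists_sees_of_limitEdge {i j : Fin n} (h : E.LimitEdge i j) (R : ℕ) :
    ∃ r ≥ R, E.Sees r i j := by
  obtain ⟨r, hr, hR⟩ := h.2.2.exists_gt R
  exact ⟨r, hR.le, hr⟩

/-- What a process knows eventually reaches all processes that reach it in the limit graph. -/
theorem exists_C_le_of_reflTransGen {i j : Fin n}
    (h : Relation.ReflTransGen E.LimitEdge i j) (s : ℕ) :
    ∃ r, (X.state s j).C ≤ (X.state r i).C := by
  induction h using Relation.ReflTransGen.head_induction_on with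
  | refl => exact ⟨s, le_rfl⟩
  | head hik _ ih =>
    obtain ⟨r, hr⟩ := ih
    obtain ⟨q, hq, hs⟩ := exists_sees_of_limitEdge hik r
    exact ⟨q + 1, hr.trans ((X.C_mono _ hq).trans (X.C_le_succ_of_sees hs))⟩

/-- If all strongly correct processes stopped, they would end up with equal counter vectors, and
equal vectors in its view let a process output. -/
theorem exists_outputsForever (X : SimExec E) : ∃ i ∈ E.strCorrect, X.OutputsForever i := by
  by_contra! hsilent
  obtain ⟨R₀, hR₀⟩ := E.exists_forall_view_subset
  have hnone : ∀ i, ∃ R, ∀ r ≥ R, i ∈ E.strCorrect → X.out r i = none := fun i => by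
    by_cases hi : i ∈ E.strCorrect
    · obtain ⟨R, hR⟩ := exists_forall_out_eq_none (hsilent i hi)
      exact ⟨R, fun r hr _ => hR r hr⟩
    · exact ⟨0, fun _ _ h => (hi h).elim⟩
  choose f hf using hnone
  set R := max R₀ (Finset.univ.sup f)
  have hout : ∀ r ≥ R, ∀ i ∈ E.strCorrect, X.out r i = none := fun r hr i hi =>
    hf i r (((Finset.le_sup (Finset.mem_univ i)).trans (le_max_right _ _)).trans hr) hi
  have hview : ∀ r ≥ R, ∀ i ∈ E.strCorrect, ∀ j ∈ E.view r i, j ∈ E.strCorrect :=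
    fun r hr => hR₀ r ((le_max_left _ _).trans hr)
  -- Every vector is bounded: entry `k` is at most the final counter of `k` if `k` is strongly
  -- correct, and otherwise it is a copy of an entry that was known in round `R`.
  let B : Fin n → ℕ := Finset.univ.sup fun j => (X.state R j).C
  have hB : ∀ r ≥ R, ∀ i ∈ E.strCorrect, (X.state r i).C ≤ B := by
    intro r hr
    induction r, hr using Nat.le_induction with
    | base => exact fun i _ => Finset.le_sup (f := fun j => (X.state R j).C) (Finset.mem_univ i)
    | succ r hr ih =>
      intro i hi k
      rcases eq_or_ne k i with rfl | hk
      · rw [X.C_succ_self_of_none (hout r hr k hi)]; exact ih k hi k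
      · obtain ⟨j, rfl | hj, hj'⟩ := X.exists_C_succ_apply_eq r hk
        · rw [hj']; exact ih j hi k
        · rw [hj']; exact ih j (hview r hr i hi j hj.2) k
  have hconst : ∀ i, ∃ T, i ∈ E.strCorrect → ∀ r ≥ T, (X.state r i).C = (X.state T i).C := by
    intro i
    by_cases hi : i ∈ E.strCorrect
    · have hfin : (Set.range fun r => (X.state r i).C).Finite := by
        refine (Set.finite_Iic B).subset ?_
        rintro _ ⟨r, rfl⟩
        exact (X.C_mono i (le_max_left r R)).trans (hB _ (le_max_right r R) i hi)
      obtain ⟨_, ⟨T, rfl⟩, hT⟩ := hfin.exists_maximal (Set.range_nonempty _)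
      exact ⟨T, fun _ r hr =>
        le_antisymm (hT ⟨r, rfl⟩ (X.C_mono i hr)) (X.C_mono i hr)⟩
    · exact ⟨0, fun h => (hi h).elim⟩
  choose g hg using hconst
  set T := max R (Finset.univ.sup g)
  have hT : ∀ i ∈ E.strCorrect, ∀ r ≥ T, (X.state r i).C = (X.state T i).C := by
    intro i hi r hr
    have : g i ≤ T := (Finset.le_sup (Finset.mem_univ i)).trans (le_max_right _ _)
    rw [hg i hi r (this.trans hr), hg i hi T this]
  have hle : ∀ i ∈ E.strCorrect, ∀ j ∈ E.strCorrect, (X.state T j).C ≤ (X.state T i).C := by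
    intro i hi j hj
    obtain ⟨r, hr⟩ := exists_C_le_of_reflTransGen (X := X)
      (IISRun.reflTransGen_of_mem_strCorrect hi hj) T
    rw [← hT i hi (max r T) (le_max_right _ _)]
    exact hr.trans (X.C_mono i (le_max_left _ _))
  obtain ⟨i, hi⟩ := E.strCorrect_nonempty
  have hsome := X.exists_out_of_canOutput (r := T) (U := (X.state T i).C) (hi.1 T)
    (Or.inl fun j hj => by
      have hj := hview T (le_max_left _ _) i hi j hj
      exact le_antisymm (hle i hi j hj) (hle j hj i hi))
  simp [hout T (le_max_left _ _) i hi] at hsome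

/-- A process that sees `b` infinitely often, while `b` hears of it and outputs forever, cannot
stop: the snapshots of `b` would eventually contain its last counter, and it would adopt one. -/
theorem OutputsForever.of_limitEdge {a b : Fin n} (hb : X.OutputsForever b)
    (hab : E.LimitEdge a b) (hba : Relation.ReflTransGen E.LimitEdge b a) :
    X.OutputsForever a := by
  by_contra ha
  obtain ⟨R, hR⟩ := exists_forall_out_eq_none ha
  obtain ⟨s, hs⟩ := exists_C_le_of_reflTransGen (X := X) hba R
  obtain ⟨t, -, -, ht, -⟩ := hb.exists_out ((X.state s b).C b + 1)
  obtain ⟨r, hr, hsees⟩ := exists_sees_of_limitEdge hab (max R t)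
  have hSI : (X.state s b).C b < (X.state r b).SI b := by
    have h₁ := X.SI_self r b
    have h₂ := X.C_mono b ((le_max_right R t).trans hr) b
    simp only at h₂
    omega
  have hself := C_self_eq_of_out_eq_none hR ((le_max_left R t).trans hr)
  have hsome := X.exists_out_of_canOutput hsees.1 (Or.inr ⟨b, hsees.2, rfl,
    le_antisymm ((X.SI_le_C r b a).trans (X.C_apply_le_self r b a))
      (hself.trans_le ((hs a).trans (X.C_le_SI_of_lt_apply hSI a)))⟩)
  simp [hR r ((le_max_left R t).trans hr)] at hsome

theorem outputsForever_of_mem_strCorrect {i : Fin n} (hi : i ∈ E.strCorrect) :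
    X.OutputsForever i := by
  obtain ⟨q, hq, hX⟩ := X.exists_outputsForever
  have hiq := IISRun.reflTransGen_of_mem_strCorrect hi hq
  induction hiq using Relation.ReflTransGen.head_induction_on with
  | refl => exact hX
  | head hab _ ih =>
    have hb := IISRun.mem_strCorrect_of_limitEdge hi hab
    exact (ih hb).of_limitEdge hab (IISRun.reflTransGen_of_mem_strCorrect hb hi)

/-! ### All other processes output only finitely often -/

theorem bddAbove_C_apply {i q : Fin n} (hi : i ∉ E.strCorrect) (hq : q ∈ E.strCorrect) :
    ∃ B, ∀ r, (X.state r q).C i ≤ B := by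
  obtain ⟨R, hR⟩ := E.exists_forall_view_subset
  let B : Fin n → ℕ := Finset.univ.sup fun j => (X.state R j).C
  have hB : ∀ r ≥ R, ∀ q ∈ E.strCorrect, (X.state r q).C i ≤ B i := by
    intro r hr
    induction r, hr using Nat.le_induction with
    | base =>
      exact fun q _ => Finset.le_sup (f := fun j => (X.state R j).C) (Finset.mem_univ q) i
    | succ r hr ih =>
      intro q hq
      obtain ⟨j, rfl | hj, hj'⟩ := X.exists_C_succ_apply_eq r
        (ne_of_mem_of_not_mem hq hi).symm
      · rw [hj']; exact ih j hq
      · rw [hj']; exact ih j (hR r hr q hq j hj.2)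
  exact ⟨B i, fun r => (X.C_mono q (le_max_left r R) i).trans (hB _ (le_max_right r R) q hq)⟩

/-- A strongly correct process does not hear of late counters of the other processes. If one of
these output forever, one of its outputs would thus be contained in no output of the strongly
correct process, hence contain all of them. -/
theorem mem_strCorrect_of_outputsForever {i : Fin n} (h : X.OutputsForever i) :
    i ∈ E.strCorrect := by
  by_contra hi
  obtain ⟨q, hq⟩ := E.strCorrect_nonempty
  obtain ⟨B, hB⟩ := bddAbove_C_apply (X := X) hi hq
  obtain ⟨r, U, hU, -, hUi⟩ := h.exists_out B
  obtain ⟨s, W, hW, -, hWq⟩ := (outputsForever_of_mem_strCorrect (X := X) hq).exists_out (U q)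
  rcases X.out_le_or_le hU hW with hle | hle
  · have h₁ : U i ≤ (X.state (s + 1) q).C i := (hle i).trans (X.out_le_C_succ hW i)
    have h₂ := hB (s + 1)
    omega
  · have h₁ : W q ≤ U q := hle q
    omega

theorem outputsForever_iff {i : Fin n} : X.OutputsForever i ↔ i ∈ E.strCorrect :=
  ⟨mem_strCorrect_of_outputsForever, outputsForever_of_mem_strCorrect⟩

/-! ### Participating sets -/

theorem apply_self_ne_zero (X : SimExec E) (r : ℕ) (i : Fin n) : (X.state r i).C i ≠ 0 := by
  rw [X.C_self_eq_count]; exact Nat.succ_ne_zero _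

theorem C_apply_ne_zero_of_awareAt {q : ℕ} {i j : Fin n} (h : E.AwareAt 0 j q i) :
    (X.state (q + 1) i).C j ≠ 0 := by
  induction h with
  | direct _ h =>
    exact (Nat.pos_of_ne_zero (X.apply_self_ne_zero _ _)).trans_le
      (X.C_le_succ_of_sees h j) |>.ne'
  | relay _ hpq h ih =>
    exact (Nat.pos_of_ne_zero ih).trans_le
      ((X.C_mono _ hpq j).trans (X.C_le_succ_of_sees h j)) |>.ne'

theorem awareAt_of_C_apply_ne_zero {r : ℕ} {i j : Fin n} (h : (X.state r i).C j ≠ 0)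
    (hij : j ≠ i) : ∃ q < r, E.AwareAt 0 j q i := by
  induction r generalizing i with
  | zero => simp [X.state_zero, SimState.init, hij] at h
  | succ r ih =>
    obtain ⟨k, hk, hC⟩ := X.exists_C_succ_apply_eq r hij
    rw [hC] at h
    rcases eq_or_ne j k with rfl | hjk
    · exact ⟨r, r.lt_succ_self, .direct (Nat.zero_le r) (hk.resolve_left hij)⟩
    · obtain ⟨q, hq, ha⟩ := ih h hjk
      rcases hk with rfl | hk
      · exact ⟨q, hq.trans r.lt_succ_self, ha⟩
      · exact ⟨r, r.lt_succ_self, ha.relay hq hk⟩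

theorem mem_partOf_iff {i j : Fin n} (hi : i ∈ E.strCorrect) :
    j ∈ E.partOf i ↔ ∃ r U, X.out r i = some U ∧ U j ≠ 0 := by
  constructor
  · rintro ⟨q, hq⟩
    -- An output numbered above the counter of round `q + 1` contains all that `i` knew then.
    obtain ⟨r, U, hU, -, hUi⟩ := (outputsForever_of_mem_strCorrect (X := X) hi).exists_out
      ((X.state (q + 1) i).C i)
    refine ⟨r, U, hU, ?_⟩
    have hSI := (X.of_out hU).2.2.1
    have hle := X.C_le_SI_of_lt_apply (s := q + 1) (b := i) (r := r + 1) (k := i)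
      (by rw [hSI, hUi]; exact Nat.lt_succ_self _) j
    rw [hSI] at hle
    exact ((Nat.pos_of_ne_zero (C_apply_ne_zero_of_awareAt hq)).trans_le hle).ne'
  · rintro ⟨r, U, hU, hj⟩
    rcases eq_or_ne j i with rfl | hji
    · exact ⟨0, .direct le_rfl ⟨hi.1 0, IISRun.self_mem_view (hi.1 0)⟩⟩
    · have hC : (X.state (r + 1) i).C j ≠ 0 :=
        ((Nat.pos_of_ne_zero hj).trans_le (X.out_le_C_succ hU j)).ne'
      obtain ⟨q, -, hq⟩ := awareAt_of_C_apply_ne_zero hC hji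
      exact ⟨q, hq⟩

end SimExec

/-! ### Runs of the atomic snapshot model -/

namespace ASConfig

variable {n : ℕ}

/-- The invariant of the reachable configurations. The register of `k` holds the number of updates
by `k` at position `k`, no other register holds more there, and the local counter of `k` is ahead
of it, by one, exactly if `k` is about to update. -/
structure Reachable (c : ASConfig n) : Prop where
  mem_le : ∀ j k, c.mem j k ≤ c.mem k k
  vec_le : ∀ j k, j ≠ k → c.vec j k ≤ c.mem k k
  vec_self : ∀ k, c.vec k k = c.mem k k + if c.updateNext k = true then 1 else 0
  vec_pos : ∀ k, 1 ≤ c.vec k k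

theorem Reachable.snapshot_apply {c : ASConfig n} (h : c.Reachable) (k : Fin n) :
    c.snapshot k = c.mem k k :=
  le_antisymm (Finset.sup_le fun j _ => h.mem_le j k)
    (Finset.le_sup (f := fun j => c.mem j k) (Finset.mem_univ k))

theorem reachable_init (n : ℕ) : (init n).Reachable where
  mem_le _ _ := le_rfl
  vec_le j k h := by simp [init, h.symm]
  vec_self k := by simp [init]
  vec_pos k := by simp [init]

theorem step_of_update {c : ASConfig n} {i : Fin n} (h : c.updateNext i = true) :
    c.step i = ⟨Function.update c.mem i (c.vec i), c.vec,
      Function.update c.updateNext i false⟩ := if_pos h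

theorem step_of_snapshot {c : ASConfig n} {i : Fin n} (h : c.updateNext i = false) :
    c.step i = ⟨c.mem, Function.update c.vec i (c.snapshot + Pi.single i 1),
      Function.update c.updateNext i true⟩ := if_neg (by simp [h])

theorem Reachable.mem_step_self {c : ASConfig n} (h : c.Reachable) (i k : Fin n) :
    (c.step i).mem k k =
      c.mem k k + if k = i ∧ c.updateNext i = true then 1 else 0 := by
  cases hu : c.updateNext i with
  | true =>
    rw [step_of_update hu]
    rcases eq_or_ne k i with rfl | hk
    · simp [h.vec_self, hu]
    · simp [hk]
  | false => rw [step_of_snapshot hu]; simp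

theorem Reachable.vec_step_self {c : ASConfig n} (h : c.Reachable) (i k : Fin n) :
    (c.step i).vec k k =
      c.vec k k + if k = i ∧ c.updateNext i = false then 1 else 0 := by
  cases hu : c.updateNext i with
  | true => rw [step_of_update hu]; simp
  | false =>
    rw [step_of_snapshot hu]
    rcases eq_or_ne k i with rfl | hk
    · simp [h.snapshot_apply, h.vec_self, hu]
    · simp [hk]

theorem Reachable.step {c : ASConfig n} (h : c.Reachable) (i : Fin n) :
    (c.step i).Reachable := by
  have hmem : ∀ k, c.mem k k ≤ (c.step i).mem k k := fun k => by
    rw [h.mem_step_self]; exact Nat.le_add_right _ _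
  have hpos : ∀ k, 1 ≤ (c.step i).vec k k := fun k => by
    rw [h.vec_step_self]; exact (h.vec_pos k).trans (Nat.le_add_right _ _)
  cases hu : c.updateNext i with
  | true =>
    refine ⟨fun j k => ?_, fun j k hjk => ?_, fun k => ?_, hpos⟩
    · rcases eq_or_ne j k with rfl | hjk
      · rfl
      refine le_trans ?_ (hmem k)
      rw [step_of_update hu]
      rcases eq_or_ne j i with rfl | hj
      · simpa using h.vec_le j k hjk
      · simpa [hj] using h.mem_le j k
    · refine le_trans ?_ (hmem k)
      rw [step_of_update hu]; exact h.vec_le j k hjk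
    · rw [h.mem_step_self, h.vec_step_self, h.vec_self, step_of_update hu]
      rcases eq_or_ne k i with rfl | hk
      · simp [hu]
      · simp [hk]
  | false =>
    refine ⟨fun j k => ?_, fun j k hjk => ?_, fun k => ?_, hpos⟩
    · rw [step_of_snapshot hu]; exact h.mem_le j k
    · refine le_trans ?_ (hmem k)
      rw [step_of_snapshot hu]
      rcases eq_or_ne j i with rfl | hj
      · simp [h.snapshot_apply, hjk.symm]
      · simpa [hj] using h.vec_le j k hjk
    · rw [h.mem_step_self, h.vec_step_self, h.vec_self, step_of_snapshot hu]
      rcases eq_or_ne k i with rfl | hk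
      · simp [hu]
      · simp [hk]

end ASConfig

namespace ASRun

variable {n : ℕ} (E : ASRun n)

theorem reachable_config (t : ℕ) : (E.config t).Reachable := by
  induction t with
  | zero => exact ASConfig.reachable_init n
  | succ t ih => exact ih.step _

theorem snap_eq_some_iff {t : ℕ} {i : Fin n} {U : Fin n → ℕ} :
    E.snap t i = some U ↔
      E.sched t = i ∧ (E.config t).updateNext i = false ∧ (E.config t).snapshot = U := by
  unfold snap; split_ifs with h
  · simp [h]
  · simp only [false_iff]; tauto

theorem isSome_snap_iff {t : ℕ} {i : Fin n} :
    (E.snap t i).isSome = true ↔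
      i = E.sched t ∧ (E.config t).updateNext (E.sched t) = false := by
  rw [Option.isSome_iff_exists]
  simp only [snap_eq_some_iff]
  constructor
  · rintro ⟨_, rfl, h, -⟩; exact ⟨rfl, h⟩
  · rintro ⟨rfl, h⟩; exact ⟨_, rfl, h, rfl⟩

theorem vec_self_eq_count (t : ℕ) (i : Fin n) :
    (E.config t).vec i i = Nat.count (fun s => (E.snap s i).isSome = true) t + 1 := by
  induction t with
  | zero => simp [config, ASConfig.init]
  | succ t ih =>
    rw [config, (E.reachable_config t).vec_step_self, Nat.count_succ, ih]
    simp only [isSome_snap_iff]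
    omega

theorem apply_self_of_snap {t : ℕ} {i : Fin n} {U : Fin n → ℕ} (h : E.snap t i = some U) :
    U i = (E.config t).vec i i := by
  obtain ⟨-, hu, rfl⟩ := E.snap_eq_some_iff.mp h
  have hr := E.reachable_config t
  rw [hr.snapshot_apply, hr.vec_self, hu]; simp

theorem mem_self_mono (k : Fin n) : Monotone fun t => (E.config t).mem k k :=
  monotone_nat_of_le_succ fun t => by
    rw [config, (E.reachable_config t).mem_step_self]; exact Nat.le_add_right _ _

theorem updateNext_eq_of_forall_ne {i : Fin n} {s t : ℕ} (hst : s ≤ t)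
    (h : ∀ q, s ≤ q → q < t → E.sched q ≠ i) :
    (E.config t).updateNext i = (E.config s).updateNext i := by
  induction t, hst using Nat.le_induction with
  | base => rfl
  | succ t hst ih =>
    rw [← ih fun q hq hqt => h q hq (by omega)]
    have hne := (h t hst t.lt_succ_self).symm
    rw [config, ASConfig.step]
    split_ifs <;> simp [hne]

/-- Since every process alternates updates and snapshots, the correct processes are those that take
infinitely many snapshots. -/
theorem mem_correct_iff {i : Fin n} :
    i ∈ E.correct ↔ {t | (E.snap t i).isSome = true}.Infinite := by
  constructor
  · intro h
    refine Set.infinite_of_forall_exists_gt fun T => ?_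
    obtain ⟨s, hs, hTs⟩ := h.exists_gt T
    cases hu : (E.config s).updateNext i with
    | false => exact ⟨s, E.isSome_snap_iff.mpr ⟨hs.symm, by rw [hs]; exact hu⟩, hTs⟩
    | true =>
      -- The next step of `i` after the update in step `s` is a snapshot.
      have hex : ∃ t, s < t ∧ E.sched t = i := by
        obtain ⟨t, ht, hst⟩ := h.exists_gt s
        exact ⟨t, hst, ht⟩
      classical
      obtain ⟨hst, ht⟩ := Nat.find_spec hex
      refine ⟨Nat.find hex, E.isSome_snap_iff.mpr ⟨ht.symm, ?_⟩, hTs.trans hst⟩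
      rw [ht, E.updateNext_eq_of_forall_ne (Nat.succ_le_of_lt hst)
        fun q hq hqt hqi => Nat.find_min hex hqt ⟨hq, hqi⟩]
      have hs' : E.sched s = i := hs
      rw [Nat.succ_eq_add_one, config, hs', ASConfig.step_of_update hu]; simp
  · exact fun h => h.mono fun t ht => (E.isSome_snap_iff.mp ht).1.symm

/-- A process participates if and only if it is seen by a given correct process, because the latter
still takes a snapshot after the first update of the former. -/
theorem partOf_eq_part {i : Fin n} (hi : i ∈ E.correct) : E.partOf i = E.part := by
  ext j
  constructor
  · rintro ⟨t, U, hU, hj⟩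
    obtain ⟨-, -, rfl⟩ := E.snap_eq_some_iff.mp hU
    rw [(E.reachable_config t).snapshot_apply] at hj
    by_contra hpart
    have h0 : ∀ s, (E.config s).mem j j = 0 := fun s => by
      induction s with
      | zero => rfl
      | succ s ih =>
        rw [config, (E.reachable_config s).mem_step_self, ih, if_neg]
        rintro ⟨hs, hu⟩
        exact hpart ⟨s, hs.symm, hs ▸ hu⟩
    exact hj (h0 t)
  · rintro ⟨s, hs, hu⟩
    obtain ⟨t, ht, hst⟩ := (E.mem_correct_iff.mp hi).exists_gt s
    obtain ⟨U, hU⟩ := Option.isSome_iff_exists.mp ht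
    refine ⟨t, U, hU, ?_⟩
    obtain ⟨-, -, rfl⟩ := E.snap_eq_some_iff.mp hU
    rw [(E.reachable_config t).snapshot_apply]
    have h₁ : (E.config (s + 1)).mem j j ≤ (E.config t).mem j j := E.mem_self_mono j hst
    rw [config, (E.reachable_config s).mem_step_self, if_pos ⟨hs.symm, hs ▸ hu⟩] at h₁
    omega

end ASRun

/-! ### Realizing a chain of vectors by snapshots -/

/-- `O i` is a possible set of snapshot values of process `i`, for all `i` in one run of the AS
model: the values form a chain, entry `i` numbers the values of `O i` from `1` on, and an entry
`U j` can only occur if `j` has taken its snapshots with smaller numbers.  There are infinitely many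
values. -/
structure IsSnapshotFamily {n : ℕ} (O : Fin n → Set (Fin n → ℕ)) : Prop where
  le_or_le : ∀ {i j U W}, U ∈ O i → W ∈ O j → U ≤ W ∨ W ≤ U
  eq_of_apply_eq : ∀ {i U W}, U ∈ O i → W ∈ O i → U i = W i → U = W
  exists_apply_eq : ∀ {i j U m}, U ∈ O i → 1 ≤ m → m < U j → ∃ W ∈ O j, W j = m
  one_le : ∀ {i U}, U ∈ O i → 1 ≤ U i
  exists_ge : ∃ i, ∀ m, ∃ U ∈ O i, m ≤ U i

namespace IsSnapshotFamily

variable {n : ℕ} {O : Fin n → Set (Fin n → ℕ)}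

/-- No snapshot that is still to be taken has been missed: the registers have not gone beyond its
value.  The snapshots `U ∈ O i` still to be taken are those with `c.vec i i ≤ U i`. -/
structure Good (O : Fin n → Set (Fin n → ℕ)) (c : ASConfig n) : Prop where
  reachable : c.Reachable
  le : ∀ {i U}, U ∈ O i → c.vec i i ≤ U i → ∀ k, c.mem k k ≤ U k

theorem good_init (O : Fin n → Set (Fin n → ℕ)) : Good O (ASConfig.init n) :=
  ⟨ASConfig.reachable_init n, fun _ _ _ => Nat.zero_le _⟩

/-- The next step aims at the least snapshot `U` that is still to be taken: take it if the number
of updates has reached `U`; otherwise let a process update of which `U` contains a later update.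
This process does not have to take a snapshot before, as that would be smaller than `U`. -/
theorem exists_good_step (hO : IsSnapshotFamily O) {c : ASConfig n} (hc : Good O c) :
    ∃ i, Good O (c.step i) ∧ (c.updateNext i = false → c.snapshot ∈ O i) := by
  have hr := hc.reachable
  obtain ⟨i₀, hi₀⟩ := hO.exists_ge
  obtain ⟨U₀, hU₀, hle₀⟩ := hi₀ (c.vec i₀ i₀)
  -- The sum of the entries is strictly monotone, so it finds the least element of the chain.
  obtain ⟨U, ⟨i, hU, hi⟩, hmin⟩ := exists_minimal_of_wellFoundedLT
    (fun U => ∃ i, U ∈ O i ∧ c.vec i i ≤ U i) ⟨U₀, i₀, hU₀, hle₀⟩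
  have hleast : ∀ {j W}, W ∈ O j → c.vec j j ≤ W j → U ≤ W := fun {j W} hW hj =>
    (hO.le_or_le hU hW).elim id fun h => hmin ⟨j, hW, hj⟩ h
  by_cases hreach : ∀ k, U k ≤ c.mem k k
  · have hsnap : c.snapshot = U := funext fun k => by
      rw [hr.snapshot_apply]; exact le_antisymm (hc.le hU hi k) (hreach k)
    refine ⟨i, ⟨hr.step i, fun {j W} hW hj k => ?_⟩, fun _ => hsnap ▸ hU⟩
    have hu : c.updateNext i = false := by
      have h₁ := hr.vec_self i
      have h₂ := hreach i
      cases hu : c.updateNext i with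
      | false => rfl
      | true => simp only [hu, if_true] at h₁; omega
    rw [hr.mem_step_self, if_neg (by simp [hu]), add_zero]
    rw [hr.vec_step_self] at hj
    exact hc.le hW ((Nat.le_add_right _ _).trans hj) k
  · push Not at hreach
    obtain ⟨j, hj⟩ := hreach
    have hu : c.updateNext j = true := by
      by_contra hu
      have hvec := hr.vec_self j
      rw [if_neg hu, add_zero] at hvec
      have hpos : 1 ≤ c.mem j j := hvec ▸ hr.vec_pos j
      obtain ⟨W, hW, hWj⟩ := hO.exists_apply_eq hU hpos hj
      have h₁ : U j ≤ W j := hleast hW (by omega) j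
      omega
    refine ⟨j, ⟨hr.step j, fun {l W} hW hl k => ?_⟩, fun h => by simp [hu] at h⟩
    rw [hr.vec_step_self, if_neg (by simp [hu]), add_zero] at hl
    rw [hr.mem_step_self]
    have h₁ := hc.le hW hl k
    have h₂ : U k ≤ W k := hleast hW hl k
    split_ifs with hk
    · obtain ⟨rfl, -⟩ := hk; omega
    · omega

/-- The total number of steps, in terms of the counters. -/
theorem sum_config (E : ASRun n) (t : ℕ) :
    ∑ k, ((E.config t).mem k k + (E.config t).vec k k) = t + n := by
  induction t with
  | zero => simp [ASRun.config, ASConfig.init]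
  | succ t ih =>
    have hr := E.reachable_config t
    have h : ∀ k, (E.config (t + 1)).mem k k + (E.config (t + 1)).vec k k =
        ((E.config t).mem k k + (E.config t).vec k k) + if k = E.sched t then 1 else 0 := by
      intro k
      rw [ASRun.config, hr.mem_step_self, hr.vec_step_self]
      cases (E.config t).updateNext (E.sched t) <;> simp <;> omega
    rw [Finset.sum_congr rfl fun k _ => h k, Finset.sum_add_distrib, ih]
    simp
    omega

theorem exists_run (hO : IsSnapshotFamily O) :
    ∃ E : ASRun n, ∀ i U, (∃ t, E.snap t i = some U) ↔ U ∈ O i := by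
  have : Nonempty (Fin n) := ⟨hO.exists_ge.choose⟩
  choose! f hf hfO using fun (c : ASConfig n) (hc : Good O c) => hO.exists_good_step hc
  let config : ℕ → ASConfig n := fun t => Nat.rec (ASConfig.init n) (fun _ c => c.step (f c)) t
  let E : ASRun n := ⟨fun t => f (config t)⟩
  have hconfig : ∀ t, E.config t = config t := fun t => by
    induction t with
    | zero => rfl
    | succ t ih => rw [ASRun.config, ih]
  have hgood : ∀ t, Good O (E.config t) := fun t => by
    induction t with
    | zero => exact good_init O
    | succ t ih =>
      have h := hf _ ih
      rw [hconfig] at h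
      rwa [hconfig]
  have hsound : ∀ {i U t}, E.snap t i = some U → U ∈ O i := fun {i U t} h => by
    obtain ⟨hs, hu, hU⟩ := E.snap_eq_some_iff.mp h
    have hs' : f (E.config t) = i := by rw [hconfig]; exact hs
    rw [← hU, ← hs']
    exact hfO _ (hgood t) (hs'.symm ▸ hu)
  refine ⟨E, fun i U => ⟨fun ⟨t, h⟩ => hsound h, fun hU => ?_⟩⟩
  -- A snapshot that is never taken would bound the number of updates, hence of all steps.
  by_contra! hnever
  have hpending : ∀ t, (E.config t).vec i i ≤ U i := fun t => by
    induction t with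
    | zero => simpa [ASRun.config, ASConfig.init] using hO.one_le hU
    | succ t ih =>
      rw [ASRun.config, (E.reachable_config t).vec_step_self]
      split_ifs with h
      · refine Nat.lt_of_le_of_ne ih fun heq => ?_
        obtain ⟨W, hW⟩ := Option.isSome_iff_exists.mp (E.isSome_snap_iff.mpr h)
        have : W = U := hO.eq_of_apply_eq (hsound hW) hU ((E.apply_self_of_snap hW).trans heq)
        exact hnever t (this ▸ hW)
      · exact ih
  have hbound : ∀ t, t + n ≤ ∑ k, (U k + (U k + 1)) := fun t => by
    rw [← sum_config E t]
    refine Finset.sum_le_sum fun k _ => ?_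
    have h₁ := (hgood t).le hU (hpending t) k
    have h₂ := (E.reachable_config t).vec_self k
    split_ifs at h₂ <;> omega
  have := hbound (∑ k, (U k + (U k + 1)) + 1)
  omega

end IsSnapshotFamily

/-! ### The simulation -/

namespace SimExec

variable {n : ℕ} {E : IISRun n} (X : SimExec E)

theorem isSnapshotFamily : IsSnapshotFamily fun i => {U | ∃ r, X.out r i = some U} where
  le_or_le := fun ⟨_, hU⟩ ⟨_, hW⟩ => X.out_le_or_le hU hW
  eq_of_apply_eq := by
    rintro i U W ⟨r, hU⟩ ⟨s, hW⟩ h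
    rw [X.apply_self_of_out hU, X.apply_self_of_out hW, X.C_self_eq_count, X.C_self_eq_count,
      add_left_inj] at h
    have hrs := Nat.count_injective (by simp [hU]) (by simp [hW]) h
    rw [hrs, hW] at hU
    exact (Option.some.inj hU).symm
  exists_apply_eq := by
    rintro i j U m ⟨r, hU⟩ hm hmU
    have hC := hmU.trans_le ((X.out_le_C_succ hU j).trans (X.C_apply_le_self (r + 1) i j))
    rw [X.C_self_eq_count] at hC
    -- The output of `j` with number `m` is its `(m - 1)`-st one, counted from `0`.
    have hlt : m - 1 < Nat.count (fun s => (X.out s j).isSome = true) (r + 1) := by omega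
    have hcard : ∀ hf : (Set.ofPred fun s => (X.out s j).isSome = true).Finite,
        m - 1 < hf.toFinset.card := fun hf => by
      refine hlt.trans_le ?_
      rw [Nat.count_eq_card_filter_range]
      exact Finset.card_le_card fun s hs =>
        hf.mem_toFinset.mpr (Finset.mem_filter.mp hs).2
    obtain ⟨W, hW⟩ := Option.isSome_iff_exists.mp (Nat.nth_mem (m - 1) hcard)
    refine ⟨W, ⟨_, hW⟩, ?_⟩
    rw [X.apply_self_of_out hW, X.C_self_eq_count, Nat.count_nth hcard]
    omega
  one_le := by
    rintro i U ⟨r, hU⟩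
    rw [X.apply_self_of_out hU]
    exact Nat.one_le_iff_ne_zero.mpr (X.apply_self_ne_zero r i)
  exists_ge := by
    obtain ⟨i, -, hi⟩ := X.exists_outputsForever
    refine ⟨i, fun m => ?_⟩
    obtain ⟨r, U, hU, -, hUi⟩ := hi.exists_out m
    exact ⟨U, ⟨r, hU⟩, by omega⟩

theorem isNth_out_iff {i : Fin n} {k : ℕ} {U : Fin n → ℕ} :
    IsNth (fun r => X.out r i) k U ↔ (∃ r, X.out r i = some U) ∧ U i = k + 1 := by
  constructor
  · rintro ⟨r, hU, hk⟩
    exact ⟨⟨r, hU⟩, by rw [X.apply_self_of_out hU, X.C_self_eq_count, hk]⟩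
  · rintro ⟨⟨r, hU⟩, hk⟩
    rw [X.apply_self_of_out hU, X.C_self_eq_count, add_left_inj] at hk
    exact ⟨r, hU, hk⟩

end SimExec

theorem ASRun.isNth_snap_iff {n : ℕ} (E : ASRun n) {i : Fin n} {k : ℕ} {U : Fin n → ℕ} :
    IsNth (fun t => E.snap t i) k U ↔ (∃ t, E.snap t i = some U) ∧ U i = k + 1 := by
  constructor
  · rintro ⟨t, hU, hk⟩
    exact ⟨⟨t, hU⟩, by rw [E.apply_self_of_snap hU, E.vec_self_eq_count, hk]⟩
  · rintro ⟨⟨t, hU⟩, hk⟩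
    rw [E.apply_self_of_snap hU, E.vec_self_eq_count, add_left_inj] at hk
    exact ⟨t, hU, hk⟩

theorem SameSequence.symm {α : Type*} {f g : ℕ → Option α} (h : SameSequence f g) :
    SameSequence g f :=
  fun k a => (h k a).symm

theorem SameSequence.infinite {α : Type*} {f g : ℕ → Option α} (h : SameSequence f g)
    (hf : {t | (f t).isSome = true}.Infinite) : {t | (g t).isSome = true}.Infinite := by
  intro hg
  obtain ⟨a, ha⟩ := Option.isSome_iff_exists.mp (Nat.nth_mem_of_infinite hf hg.toFinset.card)
  obtain ⟨t, ht, hcount⟩ := (h _ a).mp ⟨_, ha, Nat.count_nth_of_infinite hf _⟩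
  have hlt := Nat.count_lt_card (p := fun t => (g t).isSome = true) hg (n := t) (by simp [ht])
  exact hlt.ne hcount

theorem theorem2 (n : ℕ) (E : IISRun n) (X : SimExec E) :
    (∃ E' : ASRun n, IsSimulatedRun E X.out E') ∧
    ∀ E' : ASRun n, IsSimulatedRun E X.out E' →
      E.strCorrect = E'.correct ∧ ∀ i ∈ E.strCorrect, E.partOf i = E'.part := by
  constructor
  · obtain ⟨E', hE'⟩ := X.isSnapshotFamily.exists_run
    refine ⟨E', fun i k U => ?_, fun i hi => Set.ext fun j => ?_⟩
    · rw [X.isNth_out_iff, E'.isNth_snap_iff, hE' i U]; rfl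
    · rw [SimExec.mem_partOf_iff (X := X) hi]
      constructor
      · rintro ⟨r, U, hU, hj⟩
        obtain ⟨t, ht⟩ := (hE' i U).mpr ⟨r, hU⟩
        exact ⟨t, U, ht, hj⟩
      · rintro ⟨t, U, hU, hj⟩
        obtain ⟨r, hr⟩ := (hE' i U).mp ⟨t, hU⟩
        exact ⟨r, U, hr, hj⟩
  · rintro E' ⟨hseq, hpart⟩
    have hcorrect : E.strCorrect = E'.correct := Set.ext fun i => by
      rw [E'.mem_correct_iff, ← SimExec.outputsForever_iff (X := X)]
      exact ⟨(hseq i).infinite, (hseq i).symm.infinite⟩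
    exact ⟨hcorrect, fun i hi => (hpart i hi).trans (E'.partOf_eq_part (hcorrect ▸ hi))⟩
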